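/- Let $A_i\in\mathbb C^{m_i\times m_i}$ be Hermitian and $B_i\in\mathbb C^{m_i\times n}$ for $i=1,2$. Write $\preccurlyeq$ for the Löwner order ($P\preccurlyeq Q$ iff $Q-P$ is Hermitian positive semidefinite), $\mathscr R(\cdot)$ for the column space, $(\cdot)^\dagger$ for the Moore–Penrose inverse, and $i_+(H)$, $i_-(H)$ for the numbers of positive and negative eigenvalues of a Hermitian matrix $H$, counted with multiplicities. Put $$\mathcal T=\{X\in\mathbb C^{n\times n}: X=X^*,\ B_2XB_2^*\preccurlyeq A_2\},\qquad \phi(X)=A_1-B_1XB_1^*,$$ $$J=\begin{bmatrix}-A_2&B_2\\ B_2^*&0\end{bmatrix},\qquad M=\begin{bmatrix}A_1&0&B_1\\0&-A_2&B_2\\B_1^*&B_2^*&0\end{bmatrix},$$ and assume that $\mathcal T\neq\emptyset$. Then there exists $X_2\in\mathcal T$ with $\phi(X_2)\preccurlyeq\phi(X)$ for all $X\in\mathcal T$ if and only if $$\mathscr R\begin{bmatrix}0\\B_1^*\end{bmatrix}\subseteq\mathscr R(J).$$ In this case: 1. the matrix $X_0=[\,0,\ I_n\,]\,J^\dagger\begin{bmatrix}0\\I_n\end{bmatrix}$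 is a global minimizer, that is, $X_0\in\mathcal T$ and $\phi(X_0)\preccurlyeq\phi(X)$ for all $X\in\mathcal T$; 2. the least element of $\{\phi(X):X\in\mathcal T\}$ in the Löwner order is uniquely given by $$\min_{\preccurlyeq}\{\phi(X):X\in\mathcal T\}=A_1-[\,0,\ B_1\,]\,J^\dagger\begin{bmatrix}0\\B_1^*\end{bmatrix};$$ 3. its partial inertias satisfy $$i_\pm\!\left(A_1-[\,0,\ B_1\,]\,J^\dagger\begin{bmatrix}0\\B_1^*\end{bmatrix}\right)=i_\pm(M)-i_\pm(J).$$ -/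

import Mathlib

open Matrix
open scoped MatrixOrder ComplexOrder

/-- The four Penrose equations: `X` is the Moore–Penrose inverse of `A`. -/
structure IsMoorePenrose {m n : Type*} [Fintype m] [Fintype n]
    (A : Matrix m n ℂ) (X : Matrix n m ℂ) : Prop where
  mul_mul_left : A * X * A = A
  mul_mul_right : X * A * X = X
  isHermitian_left : (A * X)ᴴ = A * X
  isHermitian_right : (X * A)ᴴ = X * A

theorem IsMoorePenrose.unique {m n : Type*} [Fintype m] [Fintype n]
    {A : Matrix m n ℂ} {X Y : Matrix n m ℂ} (hX : IsMoorePenrose A X) (hY : IsMoorePenrose A Y) :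
    X = Y := by
  have h1 : A * X = A * Y := by
    have h : (A * Y * (A * X))ᴴ = A * X * (A * Y) := by
      rw [conjTranspose_mul, hX.isHermitian_left, hY.isHermitian_left]
    have e1 : A * Y * (A * X) = A * X := by rw [← Matrix.mul_assoc, hY.mul_mul_left]
    have e2 : A * X * (A * Y) = A * Y := by rw [← Matrix.mul_assoc, hX.mul_mul_left]
    rw [e1, e2, hX.isHermitian_left] at h
    exact h
  have h2 : X * A = Y * A := by
    have h : (X * A * (Y * A))ᴴ = Y * A * (X * A) := by
      rw [conjTranspose_mul, hX.isHermitian_right, hY.isHermitian_right]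
    have e1 : X * A * (Y * A) = X * A := by
      rw [Matrix.mul_assoc, ← Matrix.mul_assoc A, hY.mul_mul_left]
    have e2 : Y * A * (X * A) = Y * A := by
      rw [Matrix.mul_assoc, ← Matrix.mul_assoc A, hX.mul_mul_left]
    rw [e1, e2, hX.isHermitian_right] at h
    exact h
  rw [← hX.mul_mul_right, h2, Matrix.mul_assoc, h1, ← Matrix.mul_assoc, hY.mul_mul_right]

theorem exists_isMoorePenrose_of_isHermitian {n : Type*} [Fintype n] [DecidableEq n]
    {H : Matrix n n ℂ} (hH : H.IsHermitian) :
    ∃ G : Matrix n n ℂ, G.IsHermitian ∧ H * G * H = H ∧ G * H * G = G ∧ H * G = G * H := by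
  let U : Matrix n n ℂ := (hH.eigenvectorUnitary : Matrix n n ℂ)
  have hU : star U * U = 1 := Unitary.coe_star_mul_self hH.eigenvectorUnitary
  let d : n → ℂ := fun i => (hH.eigenvalues i : ℂ)
  have hs : H = U * diagonal d * star U := by
    conv_lhs => rw [hH.spectral_theorem, Unitary.conjStarAlgAut_apply]
    rfl
  have key : ∀ e f : n → ℂ, (U * diagonal e * star U) * (U * diagonal f * star U)
      = U * diagonal (fun i => e i * f i) * star U := by
    intro e f
    calc _ = U * diagonal e * (star U * U) * diagonal f * star U := by
            simp only [Matrix.mul_assoc]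
      _ = _ := by rw [hU, Matrix.mul_one, Matrix.mul_assoc U, diagonal_mul_diagonal]
  refine ⟨U * diagonal (fun i => (d i)⁻¹) * star U, ?_, ?_, ?_, ?_⟩
  · have : star (fun i => (d i)⁻¹) = fun i => (d i)⁻¹ := by
      funext i
      simp [d]
    simp only [IsHermitian, star_eq_conjTranspose, conjTranspose_mul, conjTranspose_conjTranspose,
      diagonal_conjTranspose, this, Matrix.mul_assoc]
  · rw [hs, key, key]
    simp only [mul_inv_mul_cancel]
  · rw [hs, key, key]
    congr 3
    funext i
    by_cases h : d i = 0 <;> simp [h]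
  · rw [hs, key, key]
    simp only [mul_comm]

theorem exists_isMoorePenrose {m n : Type*} [Fintype m] [Fintype n] (A : Matrix m n ℂ) :
    ∃ X : Matrix n m ℂ, IsMoorePenrose A X := by
  classical
  obtain ⟨G, hG, h1, h2, h3⟩ :=
    exists_isMoorePenrose_of_isHermitian (isHermitian_conjTranspose_mul_self A)
  refine ⟨G * Aᴴ, ?_, ?_, ?_, ?_⟩
  · have h_a : (Aᴴ * A) * (G * (Aᴴ * A) - 1) = 0 := by
      rw [Matrix.mul_sub, sub_eq_zero, Matrix.mul_one]
      simpa only [Matrix.mul_assoc] using h1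
    have h_b := (conjTranspose_mul_self_mul_eq_zero A _).1 h_a
    rw [Matrix.mul_sub, sub_eq_zero, Matrix.mul_one] at h_b
    simpa only [Matrix.mul_assoc] using h_b
  · calc G * Aᴴ * A * (G * Aᴴ) = (G * (Aᴴ * A) * G) * Aᴴ := by simp only [Matrix.mul_assoc]
      _ = _ := by rw [h2]
  · rw [conjTranspose_mul, conjTranspose_mul, hG.eq, conjTranspose_conjTranspose, Matrix.mul_assoc]
  · rw [Matrix.mul_assoc, conjTranspose_mul, hG.eq, (isHermitian_conjTranspose_mul_self A).eq, h3]

/-- The Moore–Penrose inverse `A†`: the unique solution of the four Penrose equations. -/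
noncomputable def mpInverse {m n : Type*} [Fintype m] [Fintype n] (A : Matrix m n ℂ) :
    Matrix n m ℂ :=
  (exists_isMoorePenrose A).choose

theorem mpInverse_spec {m n : Type*} [Fintype m] [Fintype n] (A : Matrix m n ℂ) :
    IsMoorePenrose A (mpInverse A) :=
  (exists_isMoorePenrose A).choose_spec

/-- The range (column space) of a complex matrix. -/
noncomputable def colRange {m n : Type*} [Fintype n] (A : Matrix m n ℂ) : Submodule ℂ (m → ℂ) :=
  LinearMap.range A.mulVecLin

/-- Positive partial inertia `i₊(A)`: the number of positive eigenvalues of the Hermitian matrix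
`A`, counted with multiplicities (its eigenvalues, the roots of the characteristic polynomial,
are real, so positivity is read off from the real part). -/
noncomputable def posInertia {m : Type*} [Fintype m] [DecidableEq m] (A : Matrix m m ℂ) : ℕ :=
  (A.charpoly.roots.filter fun z => 0 < z.re).card

/-- Negative partial inertia `i₋(A)`: the number of negative eigenvalues of the Hermitian matrix
`A`, counted with multiplicities. -/
noncomputable def negInertia {m : Type*} [Fintype m] [DecidableEq m] (A : Matrix m m ℂ) : ℕ :=
  (A.charpoly.roots.filter fun z => z.re < 0).card

/-- The Hermitian solutions `X` of the linear matrix inequality `B X B* ≼ A`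
(`≤` is the Löwner order). -/
def lmiSolutions {m n : ℕ} (A : Matrix (Fin m) (Fin m) ℂ) (B : Matrix (Fin m) (Fin n) ℂ) :
    Set (Matrix (Fin n) (Fin n) ℂ) :=
  {X | X.IsHermitian ∧ B * X * Bᴴ ≤ A}

/-- `φ(X) = A - B X B*`. -/
def phi {m n : ℕ} (A : Matrix (Fin m) (Fin m) ℂ) (B : Matrix (Fin m) (Fin n) ℂ)
    (X : Matrix (Fin n) (Fin n) ℂ) : Matrix (Fin m) (Fin m) ℂ :=
  A - B * X * Bᴴ

/-- The bordered matrix `J = [-A, B; B*, 0]`. -/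
def matJ {m n : ℕ} (A : Matrix (Fin m) (Fin m) ℂ) (B : Matrix (Fin m) (Fin n) ℂ) :
    Matrix (Fin m ⊕ Fin n) (Fin m ⊕ Fin n) ℂ :=
  fromBlocks (-A) B Bᴴ 0

/-- The block matrix `M = [A₁, 0, B₁; 0, -A₂, B₂; B₁*, B₂*, 0]`; its lower right `2 × 2` block
is `J = [-A₂, B₂; B₂*, 0]`. -/
def matM {m₁ m₂ n : ℕ} (A₁ : Matrix (Fin m₁) (Fin m₁) ℂ) (B₁ : Matrix (Fin m₁) (Fin n) ℂ)
    (A₂ : Matrix (Fin m₂) (Fin m₂) ℂ) (B₂ : Matrix (Fin m₂) (Fin n) ℂ) :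
    Matrix (Fin m₁ ⊕ (Fin m₂ ⊕ Fin n)) (Fin m₁ ⊕ (Fin m₂ ⊕ Fin n)) ℂ :=
  fromBlocks A₁ (fromCols 0 B₁) (fromRows 0 B₁ᴴ) (matJ A₂ B₂)

/-- `X₀ = [0, I] J† [0; I]`. -/
noncomputable def minimizerX {m n : ℕ} (A : Matrix (Fin m) (Fin m) ℂ)
    (B : Matrix (Fin m) (Fin n) ℂ) : Matrix (Fin n) (Fin n) ℂ :=
  fromCols (0 : Matrix (Fin n) (Fin m) ℂ) (1 : Matrix (Fin n) (Fin n) ℂ) * mpInverse (matJ A B) *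
    fromRows (0 : Matrix (Fin m) (Fin n) ℂ) (1 : Matrix (Fin n) (Fin n) ℂ)

/-- `A₁ - [0, B₁] J† [0; B₁*]`, with `J = [-A₂, B₂; B₂*, 0]`. -/
noncomputable def minimalMatrix {m₁ m₂ n : ℕ} (A₁ : Matrix (Fin m₁) (Fin m₁) ℂ)
    (B₁ : Matrix (Fin m₁) (Fin n) ℂ) (A₂ : Matrix (Fin m₂) (Fin m₂) ℂ)
    (B₂ : Matrix (Fin m₂) (Fin n) ℂ) : Matrix (Fin m₁) (Fin m₁) ℂ :=
  A₁ - fromCols (0 : Matrix (Fin m₁) (Fin m₂) ℂ) B₁ * mpInverse (matJ A₂ B₂) *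
    fromRows (0 : Matrix (Fin m₂) (Fin m₁) ℂ) B₁ᴴ

/-! ### Partial inertias: Sylvester's law and Schur complements. -/

section Inertia

variable {m n : Type*} [Fintype m] [DecidableEq m] [Fintype n] [DecidableEq n]

/-! Everything rests on `exists_blocks_matJ`. Write J† = [G₁, G; G*, X₀]. Because the inequality is
consistent, the off-diagonal blocks of J J† vanish, so J J† = diag(E, F) with F = B₂*G the
orthogonal projection onto the range of B₂*, and A₂G = B₂X₀. Feasibility of X₀ comes out of the same
block identities. The range condition thus says F B₁* = B₁*.

Sufficiency: with V = G B₁* one has B₂*V = B₁*, and the slack A₂ - B₂X₀B₂* annihilates V. Hence φ(X)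
- φ(X₀) = V*(A₂ - B₂XB₂*)V ≽ 0 for feasible X. Necessity: B₂(1 - F) = 0, so a minimizer may be
shifted by 1 - F, and φ would drop unless (1 - F)B₁* = 0.

The minimal value is the generalized Schur complement of J in M; under the range condition, block
elimination makes inertia additive. -/

theorem roots_charpoly_conj_diagonal {U V : Matrix m m ℂ} (hVU : V * U = 1) (d : m → ℝ) :
    (U * diagonal (fun i => (d i : ℂ)) * V).charpoly.roots =
      Finset.univ.val.map fun i => (d i : ℂ) := by
  rw [charpoly_mul_comm, ← Matrix.mul_assoc, hVU, Matrix.one_mul, charpoly_diagonal,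
    Polynomial.roots_prod _ _ (Finset.prod_ne_zero_iff.2 fun i _ => Polynomial.X_sub_C_ne_zero _)]
  simp

theorem posInertia_conj_diagonal {U V : Matrix m m ℂ} (hVU : V * U = 1) (d : m → ℝ) :
    posInertia (U * diagonal (fun i => (d i : ℂ)) * V) = Fintype.card {i // 0 < d i} := by
  rw [posInertia, roots_charpoly_conj_diagonal hVU, Multiset.filter_map, Multiset.card_map,
    Fintype.card_subtype]
  simp [Finset.card_def]

theorem negInertia_conj_diagonal {U V : Matrix m m ℂ} (hVU : V * U = 1) (d : m → ℝ) :
    negInertia (U * diagonal (fun i => (d i : ℂ)) * V) = Fintype.card {i // d i < 0} := by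
  rw [negInertia, roots_charpoly_conj_diagonal hVU, Multiset.filter_map, Multiset.card_map,
    Fintype.card_subtype]
  simp [Finset.card_def]

theorem exists_conj_diagonal {H : Matrix m m ℂ} (hH : H.IsHermitian) :
    ∃ (U : Matrix m m ℂ) (d : m → ℝ), Uᴴ * U = 1 ∧
      H = U * diagonal (fun i => (d i : ℂ)) * Uᴴ := by
  refine ⟨hH.eigenvectorUnitary, hH.eigenvalues,
    Unitary.coe_star_mul_self hH.eigenvectorUnitary, ?_⟩
  conv_lhs => rw [hH.spectral_theorem, Unitary.conjStarAlgAut_apply]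
  rfl

theorem negInertia_eq_posInertia_neg {H : Matrix m m ℂ} (hH : H.IsHermitian) :
    negInertia H = posInertia (-H) := by
  obtain ⟨U, d, hU, rfl⟩ := exists_conj_diagonal hH
  have h : -(U * diagonal (fun i => (d i : ℂ)) * Uᴴ) =
      U * diagonal (fun i => ((-d i : ℝ) : ℂ)) * Uᴴ := by
    rw [← Matrix.neg_mul, ← Matrix.mul_neg, diagonal_neg]
    simp
  rw [negInertia_conj_diagonal hU, h, posInertia_conj_diagonal hU fun i => -d i]
  simp

theorem star_dotProduct_diagonal_mulVec (d : m → ℝ) (x : m → ℂ) :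
    star x ⬝ᵥ (diagonal (fun i => (d i : ℂ)) *ᵥ x) =
      ((∑ i, d i * Complex.normSq (x i) : ℝ) : ℂ) := by
  rw [dotProduct, Complex.ofReal_sum]
  refine Finset.sum_congr rfl fun i _ => ?_
  rw [mulVec_diagonal, Complex.ofReal_mul, Complex.normSq_eq_conj_mul_self, Pi.star_apply,
    Complex.star_def]
  ring

/-- If x is supported where e > 0 and Kᴴx vanishes where d > 0, the common value of the two
quadratic forms is both ≥ 0 and ≤ 0, which forces x = 0. So the positive coordinates for e embed
linearly into those for d. -/
theorem card_pos_le_of_diagonal_congr {d : m → ℝ} {e : n → ℝ} (K : Matrix n m ℂ)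
    (h : diagonal (fun i => (e i : ℂ)) = K * diagonal (fun i => (d i : ℂ)) * Kᴴ) :
    Fintype.card {i // 0 < e i} ≤ Fintype.card {i // 0 < d i} := by
  have hform : ∀ x : n → ℂ, ∑ i, e i * Complex.normSq (x i) =
      ∑ j, d j * Complex.normSq ((Kᴴ *ᵥ x) j) := by
    intro x
    rw [← Complex.ofReal_inj, ← star_dotProduct_diagonal_mulVec, ← star_dotProduct_diagonal_mulVec,
      h, star_mulVec, conjTranspose_conjTranspose, ← dotProduct_mulVec, mulVec_mulVec,
      mulVec_mulVec, Matrix.mul_assoc]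
  let f : ({i // 0 < e i} → ℂ) →ₗ[ℂ] ({i // 0 < d i} → ℂ) :=
    LinearMap.funLeft ℂ ℂ Subtype.val ∘ₗ Kᴴ.mulVecLin ∘ₗ
      Function.ExtendByZero.linearMap ℂ Subtype.val
  have hf : Function.Injective f := by
    rw [injective_iff_map_eq_zero]
    intro x hx
    let y : n → ℂ := Function.extend Subtype.val x (0 : n → ℂ)
    have hy : ∀ i (hi : 0 < e i), y i = x ⟨i, hi⟩ := fun i hi =>
      Subtype.val_injective.extend_apply x (0 : n → ℂ) ⟨i, hi⟩
    have hy0 : ∀ i, ¬ 0 < e i → y i = 0 := fun i hi =>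
      Function.extend_apply' x (0 : n → ℂ) i fun ⟨j, hj⟩ => hi (hj ▸ j.2)
    have hx' : ∀ j, 0 < d j → (Kᴴ *ᵥ y) j = 0 := fun j hj => congrFun hx ⟨j, hj⟩
    have hpos : ∀ i ∈ Finset.univ, 0 ≤ e i * Complex.normSq (y i) := by
      intro i _
      by_cases hi : 0 < e i
      · exact mul_nonneg hi.le (Complex.normSq_nonneg _)
      · simp [hy0 i hi]
    have hnonpos : ∑ j, d j * Complex.normSq ((Kᴴ *ᵥ y) j) ≤ 0 := by
      refine Finset.sum_nonpos fun j _ => ?_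
      by_cases hj : 0 < d j
      · simp [hx' j hj]
      · exact mul_nonpos_of_nonpos_of_nonneg (not_lt.1 hj) (Complex.normSq_nonneg _)
    have hzero := (Finset.sum_eq_zero_iff_of_nonneg hpos).1
      (le_antisymm ((hform y).trans_le hnonpos) (Finset.sum_nonneg hpos))
    funext ⟨i, hi⟩
    have := hzero i (Finset.mem_univ i)
    rw [hy i hi] at this
    simpa [hi.ne'] using this
  simpa using LinearMap.finrank_le_finrank_of_injective hf

theorem posInertia_mul_mul_conjTranspose_le {H : Matrix m m ℂ} (hH : H.IsHermitian)
    (L : Matrix n m ℂ) : posInertia (L * H * Lᴴ) ≤ posInertia H := by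
  obtain ⟨V, e, hV, he⟩ := exists_conj_diagonal (isHermitian_mul_mul_conjTranspose L hH)
  obtain ⟨U, d, hU, rfl⟩ := exists_conj_diagonal hH
  rw [he, posInertia_conj_diagonal hV, posInertia_conj_diagonal hU]
  refine card_pos_le_of_diagonal_congr (Vᴴ * L * U) ?_
  calc diagonal (fun i => (e i : ℂ))
      = (Vᴴ * V) * diagonal (fun i => (e i : ℂ)) * (Vᴴ * V) := by simp [hV]
    _ = Vᴴ * (V * diagonal (fun i => (e i : ℂ)) * Vᴴ) * V := by simp only [Matrix.mul_assoc]
    _ = _ := by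
      rw [← he]
      simp only [conjTranspose_mul, conjTranspose_conjTranspose, Matrix.mul_assoc]

/-- **Sylvester's law of inertia** for the positive partial inertia. -/
theorem posInertia_congr {H : Matrix m m ℂ} (hH : H.IsHermitian) {L L' : Matrix m m ℂ}
    (hL : L' * L = 1) : posInertia (L * H * Lᴴ) = posInertia H := by
  refine le_antisymm (posInertia_mul_mul_conjTranspose_le hH L) ?_
  have h := posInertia_mul_mul_conjTranspose_le (isHermitian_mul_mul_conjTranspose L hH) L'
  have e : L' * (L * H * Lᴴ) * L'ᴴ = (L' * L) * H * (L' * L)ᴴ := by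
    simp only [conjTranspose_mul, Matrix.mul_assoc]
  rwa [e, hL, conjTranspose_one, Matrix.one_mul, Matrix.mul_one] at h

theorem posInertia_fromBlocks_zero (S : Matrix m m ℂ) (T : Matrix n n ℂ) :
    posInertia (fromBlocks S 0 0 T) = posInertia S + posInertia T := by
  rw [posInertia, charpoly_fromBlocks_zero₁₂, Polynomial.roots_mul
    (mul_ne_zero S.charpoly_monic.ne_zero T.charpoly_monic.ne_zero), Multiset.filter_add,
    Multiset.card_add, posInertia, posInertia]

/-- Additivity of the inertia over a generalized Schur complement. -/
theorem posInertia_fromBlocks_of_mul_mul_eq {A : Matrix m m ℂ} {R : Matrix m n ℂ}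
    {J G : Matrix n n ℂ} (hA : A.IsHermitian) (hJ : J.IsHermitian) (hG : G.IsHermitian)
    (hR : J * G * Rᴴ = Rᴴ) :
    posInertia (fromBlocks A R Rᴴ J) = posInertia (A - R * G * Rᴴ) + posInertia J := by
  have hR' : R * G * J = R := by
    have := congrArg conjTranspose hR
    simpa only [conjTranspose_mul, conjTranspose_conjTranspose, hJ.eq, hG.eq,
      ← Matrix.mul_assoc] using this
  have hS : (A - R * G * Rᴴ).IsHermitian := hA.sub (isHermitian_mul_mul_conjTranspose R hG)
  -- The unipotent factor [1, RG; 0, 1] carries diag(A - RGR*, J) to the bordered matrix by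
  -- congruence.
  have hL : fromBlocks 1 (-(R * G)) 0 1 * fromBlocks 1 (R * G) 0 1 =
      (1 : Matrix (m ⊕ n) (m ⊕ n) ℂ) := by
    simp [fromBlocks_multiply, fromBlocks_one]
  rw [← posInertia_fromBlocks_zero, ← posInertia_congr
    (IsHermitian.fromBlocks hS (conjTranspose_zero) hJ) hL]
  congr 1
  simp [fromBlocks_multiply, fromBlocks_conjTranspose, hG.eq, hR', ← Matrix.mul_assoc, hR]

theorem negInertia_fromBlocks_of_mul_mul_eq {A : Matrix m m ℂ} {R : Matrix m n ℂ}
    {J G : Matrix n n ℂ} (hA : A.IsHermitian) (hJ : J.IsHermitian) (hG : G.IsHermitian)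
    (hR : J * G * Rᴴ = Rᴴ) :
    negInertia (fromBlocks A R Rᴴ J) = negInertia (A - R * G * Rᴴ) + negInertia J := by
  have hS : (A - R * G * Rᴴ).IsHermitian := hA.sub (isHermitian_mul_mul_conjTranspose R hG)
  have hR' : -J * -G * (-R)ᴴ = (-R)ᴴ := by simp [hR]
  rw [negInertia_eq_posInertia_neg (IsHermitian.fromBlocks hA rfl hJ),
    negInertia_eq_posInertia_neg hS, negInertia_eq_posInertia_neg hJ, fromBlocks_neg,
    ← conjTranspose_neg, posInertia_fromBlocks_of_mul_mul_eq hA.neg hJ.neg hG.neg hR']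
  congr 2
  simp [sub_eq_add_neg, add_comm]

end Inertia

/-! ### Hermitian Moore–Penrose inverses and range inclusion. -/

section MoorePenrose

variable {m n k : Type*} [Fintype m] [Fintype n] [Fintype k]

theorem IsMoorePenrose.conjTranspose {A : Matrix m n ℂ} {X : Matrix n m ℂ}
    (h : IsMoorePenrose A X) : IsMoorePenrose Aᴴ Xᴴ where
  mul_mul_left := by
    rw [Matrix.mul_assoc, ← conjTranspose_mul, ← conjTranspose_mul, h.mul_mul_left]
  mul_mul_right := by
    rw [Matrix.mul_assoc, ← conjTranspose_mul, ← conjTranspose_mul, h.mul_mul_right]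
  isHermitian_left := by rw [← conjTranspose_mul, h.isHermitian_right, h.isHermitian_right]
  isHermitian_right := by rw [← conjTranspose_mul, h.isHermitian_left, h.isHermitian_left]

theorem isHermitian_mpInverse {H : Matrix m m ℂ} (hH : H.IsHermitian) :
    (mpInverse H).IsHermitian := by
  have h := (mpInverse_spec H).conjTranspose
  rw [hH.eq] at h
  exact h.unique (mpInverse_spec H)

theorem mul_mpInverse_comm {H : Matrix m m ℂ} (hH : H.IsHermitian) :
    H * mpInverse H = mpInverse H * H := by
  rw [← (mpInverse_spec H).isHermitian_left, conjTranspose_mul, hH.eq,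
    (isHermitian_mpInverse hH).eq]

theorem colRange_le_iff_mul_mpInverse_mul (R : Matrix m k ℂ) (J : Matrix m n ℂ) :
    colRange R ≤ colRange J ↔ J * mpInverse J * R = R := by
  classical
  constructor
  · intro h
    refine ext_of_mulVec_single fun i => ?_
    obtain ⟨y, hy⟩ := h ⟨Pi.single i 1, rfl⟩
    simp only [mulVecLin_apply] at hy
    rw [← mulVec_mulVec, ← hy, mulVec_mulVec, (mpInverse_spec J).mul_mul_left]
  · rintro h _ ⟨x, rfl⟩
    refine ⟨mpInverse J *ᵥ (R *ᵥ x), ?_⟩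
    simp only [mulVecLin_apply, mulVec_mulVec, ← Matrix.mul_assoc, h]

end MoorePenrose

/-! ### Block structure of J†. -/

section BorderedMatrix

variable {m n : ℕ} {A : Matrix (Fin m) (Fin m) ℂ} {B : Matrix (Fin m) (Fin n) ℂ}

theorem isHermitian_matJ (hA : A.IsHermitian) : (matJ A B).IsHermitian :=
  IsHermitian.fromBlocks hA.neg rfl isHermitian_zero

/-- The kernel of `J` is the product of `ker A ∩ ker B*` and `ker B`. -/
theorem mul_eq_zero_of_matJ {k : Type*} [Fintype k] (hcons : (lmiSolutions A B).Nonempty)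
    {U : Matrix (Fin m) k ℂ} {W : Matrix (Fin n) k ℂ} (hU : Bᴴ * U = 0) (hUW : A * U = B * W) :
    A * U = 0 := by
  obtain ⟨X, -, hX⟩ := hcons
  rw [Matrix.le_iff] at hX
  have hAU : (A - B * X * Bᴴ) * U = A * U := by
    rw [Matrix.sub_mul, Matrix.mul_assoc _ Bᴴ, hU, Matrix.mul_zero, sub_zero]
  obtain ⟨C, hC⟩ := CStarAlgebra.nonneg_iff_eq_star_mul_self.1 (Matrix.nonneg_iff_posSemidef.2 hX)
  rw [star_eq_conjTranspose] at hC
  -- U*AU = (B*U)*W = 0, so U is isotropic for the positive semidefinite slack A - BXB*, which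
  -- therefore kills it.
  have h0 : Uᴴ * (A * U) = 0 := by
    rw [hUW, ← Matrix.mul_assoc, ← conjTranspose_conjTranspose B, ← conjTranspose_mul, hU,
      conjTranspose_zero, Matrix.zero_mul]
  have hCU : C * U = 0 := by
    rw [← conjTranspose_mul_self_eq_zero, conjTranspose_mul, ← h0, ← hAU, hC]
    simp only [Matrix.mul_assoc]
  rw [← hAU, hC, Matrix.mul_assoc, hCU, Matrix.mul_zero]

/-- The blocks of `J†` and `J J†`, for a consistent inequality `B X B* ≼ A`. -/
theorem exists_blocks_matJ (hA : A.IsHermitian) (hcons : (lmiSolutions A B).Nonempty) :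
    ∃ (E : Matrix (Fin m) (Fin m) ℂ) (G : Matrix (Fin m) (Fin n) ℂ),
      minimizerX A B ∈ lmiSolutions A B ∧ A * G = B * minimizerX A B ∧ B * (Bᴴ * G) = B ∧
      (Bᴴ * G)ᴴ = Bᴴ * G ∧ Bᴴ * G * Bᴴ = Bᴴ ∧
      matJ A B * mpInverse (matJ A B) = fromBlocks E 0 0 (Bᴴ * G) := by
  have hJ : (matJ A B).IsHermitian := isHermitian_matJ hA
  have hX0 : minimizerX A B = (mpInverse (matJ A B)).toBlocks₂₂ := by
    rw [minimizerX]
    conv_lhs => rw [← fromBlocks_toBlocks (mpInverse (matJ A B))]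
    simp [fromCols_mul_fromBlocks, fromCols_mul_fromRows]
  rw [hX0]
  obtain ⟨hJGJ, hGJG, hJGh, -⟩ := mpInverse_spec (matJ A B)
  have hG := isHermitian_mpInverse hJ
  have hcomm := mul_mpInverse_comm hJ
  have hJJG : matJ A B * (matJ A B * mpInverse (matJ A B)) = matJ A B := by
    rw [hcomm, ← Matrix.mul_assoc, hJGJ]
  generalize mpInverse (matJ A B) = M at *
  obtain ⟨G₁, G, G', X, rfl⟩ : ∃ G₁ G G' X, M = fromBlocks G₁ G G' X :=
    ⟨_, _, _, _, (fromBlocks_toBlocks M).symm⟩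
  obtain ⟨hG₁h, rfl, -, hX⟩ := isHermitian_fromBlocks_iff.1 hG
  simp only [toBlocks_fromBlocks₂₂, matJ] at *
  have hJG : fromBlocks (-A) B Bᴴ 0 * fromBlocks G₁ G Gᴴ X =
      fromBlocks (-(A * G₁) + B * Gᴴ) (-(A * G) + B * X) (Bᴴ * G₁) (Bᴴ * G) := by
    simp [fromBlocks_multiply]
  rw [Matrix.mul_assoc, hJG] at hGJG
  rw [hJG] at hJGJ hJGh hcomm hJJG ⊢
  simp only [fromBlocks_multiply, fromBlocks_conjTranspose, fromBlocks_inj] at *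
  obtain ⟨-, hAD, -, hBD⟩ := hJJG
  obtain ⟨hEA, -, hBGB, -⟩ := hJGJ
  obtain ⟨hG₁E, -, -, -⟩ := hGJG
  obtain ⟨-, -, -, hBG⟩ := hJGh
  obtain ⟨-, hD₁₂, hD₂₁, -⟩ := hcomm
  simp only [Matrix.mul_zero, Matrix.zero_mul, add_zero] at *
  -- The off-diagonal block D = -AG + BX satisfies B*D = 0 and AD = B(B*G - 1), both read off from
  -- J(J J†) = J; consistency then gives AD = 0.
  have hAD' : A * (-(A * G) + B * X) = 0 := by
    refine mul_eq_zero_of_matJ hcons hBD (W := Bᴴ * G - 1) ?_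
    rw [Matrix.mul_sub, Matrix.mul_one, eq_sub_iff_add_eq]
    rw [Matrix.neg_mul, neg_add_eq_iff_eq_add] at hAD
    exact hAD.symm
  have hDh : (-(A * G) + B * X)ᴴ = Gᴴ * -A + X * Bᴴ := by
    simp [conjTranspose_mul, hA.eq, hX.eq]
  -- D*D = -G*(AD) + X(B*D) = 0.
  have hD : -(A * G) + B * X = 0 := by
    rw [← conjTranspose_mul_self_eq_zero]
    nth_rw 1 [hDh]
    rw [Matrix.add_mul, Matrix.mul_assoc X, hBD, Matrix.mul_assoc, Matrix.neg_mul, hAD']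
    simp
  have hBG₁ : Bᴴ * G₁ = 0 := by rw [hD₂₁, ← hDh, hD, conjTranspose_zero]
  have hAG : A * G = B * X := (neg_add_eq_zero.1 hD)
  have hBGA : B * Gᴴ * A = B * X * Bᴴ := by
    have := congrArg (fun Z => Bᴴᴴ * Zᴴ) hAG
    simp only [conjTranspose_mul, hA.eq, hX.eq, conjTranspose_conjTranspose,
      ← Matrix.mul_assoc] at this
    exact this
  have hschur : A - B * X * Bᴴ = -(A * G₁ * A) := by
    rw [hD, Matrix.zero_mul, add_zero, Matrix.mul_neg, neg_inj, Matrix.add_mul, hBGA,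
      Matrix.neg_mul, neg_add_eq_iff_eq_add] at hEA
    rw [hEA]
    abel
  have hG₁ : -(G₁ * A * G₁) = G₁ := by
    rw [hBG₁, Matrix.mul_zero, add_zero, Matrix.mul_add, ← Matrix.mul_assoc G₁ B, ← hD₁₂, hD,
      Matrix.zero_mul, add_zero, Matrix.mul_neg, ← Matrix.mul_assoc] at hG₁E
    exact hG₁E
  refine ⟨-(A * G₁) + B * Gᴴ, G, ⟨hX, ?_⟩, hAG, ?_, hBG, ?_, rfl, hD, hBG₁, rfl⟩
  · obtain ⟨Y, -, hY⟩ := hcons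
    rw [Matrix.le_iff] at hY ⊢
    have h := hY.conjTranspose_mul_mul_same (G₁ * A)
    -- Since B*G₁ = 0, congruence by G₁A erases Y: the slack of any feasible Y is sent to the slack
    -- of X₀, which is therefore positive semidefinite.
    have e : (G₁ * A)ᴴ * (A - B * Y * Bᴴ) * (G₁ * A) = -(A * G₁ * A) := by
      calc (G₁ * A)ᴴ * (A - B * Y * Bᴴ) * (G₁ * A)
          = A * (G₁ * A * G₁) * A - A * G₁ * B * Y * (Bᴴ * G₁) * A := by
            rw [conjTranspose_mul, hA.eq, hG₁h.eq]
            simp only [Matrix.mul_sub, Matrix.sub_mul, Matrix.mul_assoc]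
        _ = -(A * -(G₁ * A * G₁) * A) := by rw [hBG₁]; simp
        _ = _ := by rw [hG₁]
    rwa [hschur, ← e]
  · rwa [hD, Matrix.mul_zero, zero_add] at hAD
  · rwa [hBG₁, Matrix.zero_mul, zero_add] at hBGB

end BorderedMatrix

/-! ### Optimality of X₀ and necessity of the range condition. -/

section Optimization

variable {m₁ m₂ n : ℕ} {A₁ : Matrix (Fin m₁) (Fin m₁) ℂ} {B₁ : Matrix (Fin m₁) (Fin n) ℂ}
  {A₂ : Matrix (Fin m₂) (Fin m₂) ℂ} {B₂ : Matrix (Fin m₂) (Fin n) ℂ}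

theorem minimalMatrix_eq_phi_minimizerX :
    minimalMatrix A₁ B₁ A₂ B₂ = phi A₁ B₁ (minimizerX A₂ B₂) := by
  have hl : fromCols (0 : Matrix (Fin m₁) (Fin m₂) ℂ) B₁ =
      B₁ * fromCols (0 : Matrix (Fin n) (Fin m₂) ℂ) (1 : Matrix (Fin n) (Fin n) ℂ) := by
    simp [mul_fromCols]
  have hr : fromRows (0 : Matrix (Fin m₂) (Fin m₁) ℂ) B₁ᴴ =
      fromRows (0 : Matrix (Fin m₂) (Fin n) ℂ) (1 : Matrix (Fin n) (Fin n) ℂ) * B₁ᴴ := by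
    simp [fromRows_mul]
  rw [minimalMatrix, phi, minimizerX, hl, hr]
  simp only [Matrix.mul_assoc]

theorem colRange_le_matJ_iff {E : Matrix (Fin m₂) (Fin m₂) ℂ} {F : Matrix (Fin n) (Fin n) ℂ}
    (h : matJ A₂ B₂ * mpInverse (matJ A₂ B₂) = fromBlocks E 0 0 F) :
    colRange (fromRows (0 : Matrix (Fin m₂) (Fin m₁) ℂ) B₁ᴴ) ≤ colRange (matJ A₂ B₂) ↔
      F * B₁ᴴ = B₁ᴴ := by
  rw [colRange_le_iff_mul_mpInverse_mul, h, fromBlocks_mul_fromRows]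
  simp [fromRows_ext_iff]

theorem phi_minimizerX_le (hA₂ : A₂.IsHermitian)
    (h : colRange (fromRows (0 : Matrix (Fin m₂) (Fin m₁) ℂ) B₁ᴴ) ≤ colRange (matJ A₂ B₂))
    {X : Matrix (Fin n) (Fin n) ℂ} (hX : X ∈ lmiSolutions A₂ B₂) :
    phi A₁ B₁ (minimizerX A₂ B₂) ≤ phi A₁ B₁ X := by
  obtain ⟨E, G, -, hAG, -, -, -, hJ⟩ := exists_blocks_matJ hA₂ ⟨X, hX⟩
  have hB : B₂ᴴ * (G * B₁ᴴ) = B₁ᴴ := by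
    rw [← Matrix.mul_assoc]
    exact (colRange_le_matJ_iff hJ).1 h
  have hB' : (G * B₁ᴴ)ᴴ * B₂ = B₁ := by
    rw [← conjTranspose_conjTranspose B₂, ← conjTranspose_mul, hB, conjTranspose_conjTranspose]
  have hzero : (A₂ - B₂ * minimizerX A₂ B₂ * B₂ᴴ) * (G * B₁ᴴ) = 0 := by
    rw [Matrix.sub_mul, Matrix.mul_assoc _ B₂ᴴ, hB, ← Matrix.mul_assoc, hAG, sub_self]
  have hpos := (Matrix.le_iff.1 hX.2).conjTranspose_mul_mul_same (G * B₁ᴴ)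
  rw [Matrix.le_iff]
  convert hpos using 1
  calc phi A₁ B₁ X - phi A₁ B₁ (minimizerX A₂ B₂)
      = B₁ * (minimizerX A₂ B₂ - X) * B₁ᴴ := by
        simp only [phi, Matrix.mul_sub, Matrix.sub_mul]
        abel
    _ = ((G * B₁ᴴ)ᴴ * B₂) * (minimizerX A₂ B₂ - X) * (B₂ᴴ * (G * B₁ᴴ)) := by rw [hB', hB]
    _ = (G * B₁ᴴ)ᴴ * (B₂ * (minimizerX A₂ B₂ - X) * B₂ᴴ) * (G * B₁ᴴ) := by
        simp only [Matrix.mul_assoc]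
    _ = (G * B₁ᴴ)ᴴ * ((A₂ - B₂ * X * B₂ᴴ) - (A₂ - B₂ * minimizerX A₂ B₂ * B₂ᴴ)) *
          (G * B₁ᴴ) := by
        congr 2
        simp only [Matrix.mul_sub, Matrix.sub_mul]
        abel
    _ = _ := by
        rw [Matrix.mul_sub, Matrix.sub_mul, Matrix.mul_assoc _ (_ - _) (G * B₁ᴴ),
          Matrix.mul_assoc _ (_ - _) (G * B₁ᴴ), hzero, Matrix.mul_zero, sub_zero,
          Matrix.mul_assoc]

theorem colRange_le_matJ_of_isMin (hA₂ : A₂.IsHermitian) {X₂ : Matrix (Fin n) (Fin n) ℂ}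
    (hX₂ : X₂ ∈ lmiSolutions A₂ B₂)
    (hmin : ∀ X ∈ lmiSolutions A₂ B₂, phi A₁ B₁ X₂ ≤ phi A₁ B₁ X) :
    colRange (fromRows (0 : Matrix (Fin m₂) (Fin m₁) ℂ) B₁ᴴ) ≤ colRange (matJ A₂ B₂) := by
  obtain ⟨E, G, -, -, hBBG, hherm, hBGB, hJ⟩ := exists_blocks_matJ hA₂ ⟨X₂, hX₂⟩
  rw [colRange_le_matJ_iff hJ]
  generalize hF : B₂ᴴ * G = F at *
  have hN : (1 - F).IsHermitian := isHermitian_one.sub hherm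
  have hBN : B₂ * (1 - F) = 0 := by rw [Matrix.mul_sub, hBBG, Matrix.mul_one, sub_self]
  have hNN : (1 - F) * (1 - F) = 1 - F := by
    have hFF : F * F = F := by
      conv_lhs => rw [← hF, ← Matrix.mul_assoc, hF, hBGB, hF]
    simp [Matrix.mul_sub, Matrix.sub_mul, hFF]
  -- The shift 1 - F projects onto ker B₂, so the constraint does not see it.
  have hmem : X₂ + (1 - F) ∈ lmiSolutions A₂ B₂ := by
    refine ⟨hX₂.1.add hN, ?_⟩
    rw [Matrix.mul_add, hBN, add_zero]
    exact hX₂.2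
  have hle := Matrix.le_iff.1 (hmin _ hmem)
  have hsq : phi A₁ B₁ (X₂ + (1 - F)) - phi A₁ B₁ X₂ =
      -(((1 - F) * B₁ᴴ)ᴴ * ((1 - F) * B₁ᴴ)) := by
    rw [conjTranspose_mul, hN.eq, conjTranspose_conjTranspose, Matrix.mul_assoc,
      ← Matrix.mul_assoc (1 - F), hNN, phi, phi, Matrix.mul_add, Matrix.add_mul,
      Matrix.mul_assoc B₁ (1 - F)]
    abel
  rw [hsq, ← Matrix.nonneg_iff_posSemidef, neg_nonneg] at hle
  have h0 := le_antisymm hle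
    (Matrix.nonneg_iff_posSemidef.2 (posSemidef_conjTranspose_mul_self _))
  rw [conjTranspose_mul_self_eq_zero, Matrix.sub_mul, Matrix.one_mul, sub_eq_zero] at h0
  exact h0.symm

end Optimization

/-! ### The main theorem. -/

theorem theorem4p2 {m₁ m₂ n : ℕ}
    (A₁ : Matrix (Fin m₁) (Fin m₁) ℂ) (hA₁ : A₁.IsHermitian)
    (A₂ : Matrix (Fin m₂) (Fin m₂) ℂ) (hA₂ : A₂.IsHermitian)
    (B₁ : Matrix (Fin m₁) (Fin n) ℂ) (B₂ : Matrix (Fin m₂) (Fin n) ℂ)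
    (hcons : (lmiSolutions A₂ B₂).Nonempty) :
    ((∃ X₂ ∈ lmiSolutions A₂ B₂, ∀ X ∈ lmiSolutions A₂ B₂, phi A₁ B₁ X₂ ≤ phi A₁ B₁ X) ↔
      colRange (fromRows (0 : Matrix (Fin m₂) (Fin m₁) ℂ) B₁ᴴ) ≤ colRange (matJ A₂ B₂)) ∧
    (colRange (fromRows (0 : Matrix (Fin m₂) (Fin m₁) ℂ) B₁ᴴ) ≤ colRange (matJ A₂ B₂) →
      (minimizerX A₂ B₂ ∈ lmiSolutions A₂ B₂ ∧
        ∀ X ∈ lmiSolutions A₂ B₂, phi A₁ B₁ (minimizerX A₂ B₂) ≤ phi A₁ B₁ X) ∧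
      (IsLeast (phi A₁ B₁ '' lmiSolutions A₂ B₂) (minimalMatrix A₁ B₁ A₂ B₂) ∧
        ∀ S, IsLeast (phi A₁ B₁ '' lmiSolutions A₂ B₂) S → S = minimalMatrix A₁ B₁ A₂ B₂) ∧
      (posInertia (minimalMatrix A₁ B₁ A₂ B₂) : ℤ) =
        (posInertia (matM A₁ B₁ A₂ B₂) : ℤ) - (posInertia (matJ A₂ B₂) : ℤ) ∧
      (negInertia (minimalMatrix A₁ B₁ A₂ B₂) : ℤ) =
        (negInertia (matM A₁ B₁ A₂ B₂) : ℤ) - (negInertia (matJ A₂ B₂) : ℤ)) := by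
  have hJ : (matJ A₂ B₂).IsHermitian := isHermitian_matJ hA₂
  have hmem : minimizerX A₂ B₂ ∈ lmiSolutions A₂ B₂ := by
    obtain ⟨-, -, h, -⟩ := exists_blocks_matJ hA₂ hcons
    exact h
  refine ⟨⟨fun ⟨X₂, hX₂, hmin⟩ => colRange_le_matJ_of_isMin hA₂ hX₂ hmin,
    fun h => ⟨_, hmem, fun X hX => phi_minimizerX_le hA₂ h hX⟩⟩, fun h => ?_⟩
  have hleast : IsLeast (phi A₁ B₁ '' lmiSolutions A₂ B₂) (minimalMatrix A₁ B₁ A₂ B₂) := by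
    rw [minimalMatrix_eq_phi_minimizerX]
    refine ⟨⟨_, hmem, rfl⟩, ?_⟩
    rintro _ ⟨X, hX, rfl⟩
    exact phi_minimizerX_le hA₂ h hX
  have hR : (fromCols (0 : Matrix (Fin m₁) (Fin m₂) ℂ) B₁)ᴴ = fromRows 0 B₁ᴴ := by
    rw [conjTranspose_fromCols_eq_fromRows_conjTranspose, conjTranspose_zero]
  have hJR := (colRange_le_iff_mul_mpInverse_mul _ _).1 h
  rw [← hR] at hJR
  refine ⟨⟨hmem, fun X hX => phi_minimizerX_le hA₂ h hX⟩,
    ⟨hleast, fun S hS => hS.unique hleast⟩, ?_, ?_⟩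
  · rw [matM, minimalMatrix, ← hR,
      posInertia_fromBlocks_of_mul_mul_eq hA₁ hJ (isHermitian_mpInverse hJ) hJR]
    push_cast
    ring
  · rw [matM, minimalMatrix, ← hR,
      negInertia_fromBlocks_of_mul_mul_eq hA₁ hJ (isHermitian_mpInverse hJ) hJR]
    push_cast
    ring
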